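/- Let $H_0$ be a separable infinite-dimensional complex Hilbert space, let $H$ and $H_n$, $n\in\mathbb N$, be closed subspaces of $H_0$ with orthogonal projections $P:H_0\to H$, $P_n:H_0\to H_n$, and assume that $P_nx\to Px$ for every $x\in H_0$. Let $T$ and $T_n$, $n\in\mathbb N$, be closed, densely defined linear operators acting in $H$ and $H_n$, respectively, with spectra $\sigma(\cdot)$, resolvent sets $\rho(\cdot)=\mathbb C\setminus\sigma(\cdot)$ and Hilbert space adjoints $T^*$, $T_n^*$. We use the following notions. - $T_n\to T$ in generalised strong resolvent sense, written $T_n\overset{gsr}{\to}T$, means that there exist $n_0\in\mathbb N$ and $\lambda_0\in\rho(T)\cap\bigcap_{n\ge n_0}\rho(T_n)$ with $(T_n-\lambda_0)^{-1}P_nx\to(T-\lambda_0)^{-1}Px$ for every $x\in H_0$; likewise for $T_n^*\overset{gsr}{\to}T^*$. - The limiting essential spectrum $\sigma_{\rm ess}((T_n)_{n\in\mathbb N})$ is the set of all $\lambda\in\mathbb C$ for which there exist an infinite set $I\subset\mathbb N$ and $x_n\in{\rm dom}(T_n)$, $n\in I$, with $\|x_n\|=1$, $x_n\to0$ weakly in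 $H_0$ and $\|(T_n-\lambda)x_n\|\to0$ as $n\to\infty$, $n\in I$; likewise for $(T_n^*)_{n\in\mathbb N}$. For $\Omega\subset\mathbb C$ put $\Omega^*=\{\overline z: z\in\Omega\}$. - Spectral pollution is confined to a set $S\subset\mathbb C$ if every $\lambda\notin\sigma(T)$ for which there exist an infinite set $I\subset\mathbb N$ and $\lambda_n\in\sigma(T_n)$, $n\in I$, with $\lambda_n\to\lambda$ as $n\to\infty$, $n\in I$, belongs to $S$. - $T_n$ has compact resolvent if $(T_n-\lambda)^{-1}$ is compact for some (equivalently, $\rho(T_n)\ne\emptyset$ and it is compact for every) $\lambda\in\rho(T_n)$. - For $\Omega,\Sigma\subset\mathbb C$, ${\rm d_H}(\Omega,\Sigma)=\max\{\sup_{z\in\Omega}{\rm dist}(z,\Sigma),\sup_{z\in\Sigma}{\rm dist}(z,\Omega)\}\in[0,\infty]$ is the Hausdorff distance, where ${\rm dist}(z,\emptyset)=\infty$ and $\sup\emptyset=0$. Then the following hold. (i) If $T_n\overset{gsr}{\to}T$ and $T_n^*\overset{gsr}{\to}T^*$, then spectral pollution is confined to the set $$\sigma_{\rm ess}\big((T_n)_{n\in\mathbb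 N}\big)\cup\sigma_{\rm ess}\big((T_n^*)_{n\in\mathbb N}\big)^*,\qquad(1)$$ and for every isolated point $\lambda$ of $\sigma(T)$ that does not belong to the set (1) there exist $\lambda_n\in\sigma(T_n)$, for all sufficiently large $n$, with $\lambda_n\to\lambda$ as $n\to\infty$. (ii) If $T_n\overset{gsr}{\to}T$ and the operators $T_n$, $n\in\mathbb N$, all have compact resolvents, then both claims of (i) hold with the set (1) replaced by the set $$\sigma_{\rm ess}\big((T_n^*)_{n\in\mathbb N}\big)^*.\qquad(2)$$ (iii) Suppose that the assumptions of (i) or of (ii) hold, and let $K\subset\mathbb C$ be a compact set such that $K\cap\sigma(T)$ is discrete (in its subspace topology) and contained in the interior of $K$. If the intersection of $K$ with the set (1) or (2), respectively, is contained in $\sigma(T)$, then $${\rm d_H}\big(\sigma(T_n)\cap K,\ \sigma(T)\cap K\big)\to0,\qquad n\to\infty.$$ -/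

import Mathlib

open Filter Topology

namespace UnboundedOp

section Single

variable {E : Type*} [NormedAddCommGroup E] [InnerProductSpace ℂ E]

/-- The bounded everywhere defined operator `R` is the two-sided inverse of
`T - z : dom T → E`. -/
def IsResolventAt (T : E →ₗ.[ℂ] E) (z : ℂ) (R : E →L[ℂ] E) : Prop :=
  (∀ y : E, ∃ h : R y ∈ T.domain, T ⟨R y, h⟩ - z • R y = y) ∧
    ∀ x : T.domain, R (T x - z • (x : E)) = x

/-- The resolvent set `ρ(T)`: all `z` such that `T - z : dom T → E` is bijective with bounded
inverse. -/
def resolventSet (T : E →ₗ.[ℂ] E) : Set ℂ := {z | ∃ R : E →L[ℂ] E, IsResolventAt T z R}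

/-- The spectrum `σ(T) = ℂ \ ρ(T)`. -/
def spectrum (T : E →ₗ.[ℂ] E) : Set ℂ := (resolventSet T)ᶜ

open Classical in
/-- The resolvent `(T - z)⁻¹` for `z ∈ ρ(T)` (and `0` for `z ∉ ρ(T)`). -/
noncomputable def resolvent (T : E →ₗ.[ℂ] E) (z : ℂ) : E →L[ℂ] E :=
  if h : ∃ R : E →L[ℂ] E, IsResolventAt T z R then h.choose else 0

theorem isResolventAt_resolvent {T : E →ₗ.[ℂ] E} {z : ℂ} (hz : z ∈ resolventSet T) :
    IsResolventAt T z (resolvent T z) := by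
  have h : ∃ R : E →L[ℂ] E, IsResolventAt T z R := hz
  simp only [resolvent, dif_pos h]
  exact h.choose_spec

theorem IsResolventAt.unique {T : E →ₗ.[ℂ] E} {z : ℂ} {R S : E →L[ℂ] E}
    (hR : IsResolventAt T z R) (hS : IsResolventAt T z S) : R = S := by
  ext y
  obtain ⟨h, hy⟩ := hS.1 y
  have := hR.2 ⟨S y, h⟩
  rw [hy] at this
  exact this

/-- `T` has compact resolvent: `(T - z)⁻¹` exists and is a compact operator for some (equivalently,
`ρ(T)` is nonempty and it is compact for every) `z ∈ ρ(T)`. -/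
def HasCompactResolvent (T : E →ₗ.[ℂ] E) : Prop :=
  ∃ z ∈ resolventSet T, IsCompactOperator (resolvent T z)

end Single

section Sequences

variable {H₀ : Type*} [NormedAddCommGroup H₀] [InnerProductSpace ℂ H₀]

/-- Convergence in generalised strong resolvent sense of the operators `Tn n`, acting in the
subspaces `Hn n`, to the operator `T`, acting in the subspace `H`: there are `n₀` and a point
`z ∈ ρ(T)` with `z ∈ ρ(Tn n)` for all `n ≥ n₀` such that `(Tn n - z)⁻¹ Pₙ x → (T - z)⁻¹ P x` in `H₀`
for every `x ∈ H₀`, with `Pₙ`, `P` the orthogonal projections onto `Hn n`, `H`. -/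
def ConvergesGSR {Hn : ℕ → Submodule ℂ H₀} [∀ n, (Hn n).HasOrthogonalProjection]
    {H : Submodule ℂ H₀} [H.HasOrthogonalProjection]
    (Tn : ∀ n, Hn n →ₗ.[ℂ] Hn n) (T : H →ₗ.[ℂ] H) : Prop :=
  ∃ (n₀ : ℕ) (z : ℂ), (∀ n, n₀ ≤ n → z ∈ resolventSet (Tn n)) ∧ z ∈ resolventSet T ∧
    ∀ x : H₀, Tendsto (fun n => (resolvent (Tn n) z ((Hn n).orthogonalProjectionOnto x) : H₀)) atTop
      (𝓝 (resolvent T z (H.orthogonalProjectionOnto x) : H₀))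

/-- The limiting essential spectrum of a sequence of operators: all `z` for which there are an
infinite set `I` of indices and unit vectors `xₙ ∈ dom (Tn n)`, `n ∈ I`, with `xₙ → 0` weakly in `H₀`
and `‖(Tn n - z) xₙ‖ → 0` as `n → ∞` in `I`. (The values `x n` for `n ∉ I` play no role.) -/
def limitingEssSpectrum {Hn : ℕ → Submodule ℂ H₀} (Tn : ∀ n, Hn n →ₗ.[ℂ] Hn n) : Set ℂ :=
  {z | ∃ (I : Set ℕ) (x : ∀ n, (Tn n).domain), I.Infinite ∧
    (∀ n ∈ I, ‖((x n : Hn n) : H₀)‖ = 1) ∧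
    (∀ y : H₀, Tendsto (fun n => inner ℂ y ((x n : Hn n) : H₀)) (atTop ⊓ 𝓟 I) (𝓝 0)) ∧
    Tendsto (fun n => ‖Tn n (x n) - z • (x n : Hn n)‖) (atTop ⊓ 𝓟 I) (𝓝 0)}

/-- The complex conjugate `Ω* = {conj z : z ∈ Ω}` of a set. -/
def conjSet (Ω : Set ℂ) : Set ℂ := (starRingEnd ℂ) '' Ω

/-- The point `z` is spectral pollution for the approximation `Tn` of `T`: `z ∉ σ(T)`, but there
are an infinite set `I` of indices and `zₙ ∈ σ(Tn n)`, `n ∈ I`, with `zₙ → z` as `n → ∞` in `I`. -/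
def IsSpectralPollution {Hn : ℕ → Submodule ℂ H₀} {H : Submodule ℂ H₀}
    (Tn : ∀ n, Hn n →ₗ.[ℂ] Hn n) (T : H →ₗ.[ℂ] H) (z : ℂ) : Prop :=
  z ∉ spectrum T ∧ ∃ (I : Set ℕ) (w : ℕ → ℂ), I.Infinite ∧ (∀ n ∈ I, w n ∈ spectrum (Tn n)) ∧
    Tendsto w (atTop ⊓ 𝓟 I) (𝓝 z)

/-- `z` is a limit of points `zₙ ∈ σ(Tn n)`. Since finitely many of the spectra may be empty,
`zₙ ∈ σ(Tn n)` is required for all sufficiently large `n`. -/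
def IsLimitOfSpectra {Hn : ℕ → Submodule ℂ H₀} (Tn : ∀ n, Hn n →ₗ.[ℂ] Hn n) (z : ℂ) : Prop :=
  ∃ w : ℕ → ℂ, (∀ᶠ n in atTop, w n ∈ spectrum (Tn n)) ∧ Tendsto w atTop (𝓝 z)

/-- Spectral pollution is confined to `S`, and every isolated point of `σ(T)` outside `S` is a
limit of points of `σ(Tn n)`. -/
def SpectrallyExactOutside {Hn : ℕ → Submodule ℂ H₀} {H : Submodule ℂ H₀}
    (Tn : ∀ n, Hn n →ₗ.[ℂ] Hn n) (T : H →ₗ.[ℂ] H) (S : Set ℂ) : Prop :=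
  (∀ z, IsSpectralPollution Tn T z → z ∈ S) ∧
    ∀ z ∈ spectrum T, (∀ᶠ w in 𝓝[≠] z, w ∉ spectrum T) → z ∉ S → IsLimitOfSpectra Tn z

end Sequences

end UnboundedOp

/-! The key notion is `regionOfBoundedness`: the points where the resolvents of `Tn n` exist for
large `n` with a common bound. Every point of `ρ(T)` outside (1), respectively (2), lies in it. By
`exists_eventually_boundedBelow`, if the operators `(Tn n)* - conj z` had no common lower bound,
there would be unit vectors `xₙ` with `((Tn n)* - conj z) xₙ → 0` along a subsequence. Strong
resolvent convergence and `z ∈ ρ(T)` force `xₙ → 0` weakly, so `conj z` would lie in the limiting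
essential spectrum of the adjoints. In (i) the same argument with the roles exchanged bounds `Tn n -
z` below, and the two bounds give bijectivity. In (ii) the Fredholm alternative replaces the second
bound.

A uniform resolvent bound persists on a neighbourhood independent of `n`, which excludes pollution.
If an isolated point `z` of `σ(T)` were not approximated, then for infinitely many `n` a fixed disc
around `z` would lie in `ρ(Tn n)`. The maximum principle carries the bound from its boundary circle
to `z`, strong convergence passes it to `T`, and the Neumann series from a nearby point of `ρ(T)`
gives `z ∈ ρ(T)`, a contradiction. Part (iii) adds compactness of `K` and finiteness of `K ∩ σ(T)`.
-/

namespace UnboundedOp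

/-! ### Resolvents, lower bounds, adjoints and compactness for a single operator. -/

section BoundedBelow

variable {E : Type*} [NormedAddCommGroup E] [InnerProductSpace ℂ E]

/-- `T - z` is bounded below by `C⁻¹`. -/
def BoundedBelow (T : E →ₗ.[ℂ] E) (z : ℂ) (C : ℝ) : Prop :=
  ∀ x : T.domain, ‖(x : E)‖ ≤ C * ‖T x - z • (x : E)‖

/-- The points of `ρ(T)` at which the resolvent has norm at most `C`. -/
def resolventBound (T : E →ₗ.[ℂ] E) (C : ℝ) : Set ℂ :=
  {z | z ∈ resolventSet T ∧ BoundedBelow T z C}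

theorem BoundedBelow.mono {T : E →ₗ.[ℂ] E} {z : ℂ} {C D : ℝ} (h : BoundedBelow T z C)
    (hCD : C ≤ D) : BoundedBelow T z D := fun x =>
  (h x).trans (mul_le_mul_of_nonneg_right hCD (norm_nonneg _))

theorem resolventBound_mono {T : E →ₗ.[ℂ] E} {C D : ℝ} (hCD : C ≤ D) :
    resolventBound T C ⊆ resolventBound T D := fun _ h => ⟨h.1, h.2.mono hCD⟩

theorem IsResolventAt.boundedBelow {T : E →ₗ.[ℂ] E} {z : ℂ} {R : E →L[ℂ] E}
    (hR : IsResolventAt T z R) : BoundedBelow T z ‖R‖ := fun x => by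
  simpa [hR.2 x] using R.le_opNorm (T x - z • (x : E))

theorem IsResolventAt.norm_le {T : E →ₗ.[ℂ] E} {z : ℂ} {R : E →L[ℂ] E} {C : ℝ}
    (hR : IsResolventAt T z R) (hC : 0 ≤ C) (h : BoundedBelow T z C) : ‖R‖ ≤ C := by
  refine R.opNorm_le_bound hC fun y => ?_
  obtain ⟨hy, hy'⟩ := hR.1 y
  simpa [hy'] using h ⟨R y, hy⟩

theorem BoundedBelow.eq_zero {T : E →ₗ.[ℂ] E} {z : ℂ} {C : ℝ} (h : BoundedBelow T z C)
    (x : T.domain) (hx : T x = z • (x : E)) : (x : E) = 0 := by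
  simpa [hx] using h x

theorem BoundedBelow.perturb {T : E →ₗ.[ℂ] E} {z w : ℂ} {C : ℝ} (h : BoundedBelow T z C)
    (hC : 0 ≤ C) (hw : C * ‖w - z‖ ≤ 1 / 2) : BoundedBelow T w (2 * C) := fun x => by
  have h1 : T x - z • (x : E) = (T x - w • (x : E)) + (w - z) • (x : E) := by module
  have h2 : ‖T x - z • (x : E)‖ ≤ ‖T x - w • (x : E)‖ + ‖w - z‖ * ‖(x : E)‖ := by
    rw [h1, ← norm_smul]
    exact norm_add_le _ _
  nlinarith [h x, mul_le_mul_of_nonneg_left h2 hC,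
    mul_le_mul_of_nonneg_right hw (norm_nonneg (x : E))]

/-- On `dom T` one has `T - w = (1 - (w - z) R)(T - z)`. Assuming only invertibility of the factor,
not a small norm, serves both the Neumann series and the Fredholm alternative. -/
theorem IsResolventAt.of_isUnit {T : E →ₗ.[ℂ] E} {z w : ℂ} {R : E →L[ℂ] E}
    (hR : IsResolventAt T z R) (hu : IsUnit (1 - (w - z) • R)) :
    IsResolventAt T w (R * Ring.inverse (1 - (w - z) • R)) := by
  obtain ⟨u, hu⟩ := hu
  rw [← hu, Ring.inverse_unit]
  refine ⟨fun y => ?_, fun x => ?_⟩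
  · set v := (↑u⁻¹ : E →L[ℂ] E) y with hv
    have h1 : v - (w - z) • R v = y := by
      have : (u * ↑u⁻¹ : E →L[ℂ] E) y = y := by simp
      simpa [hu] using this
    obtain ⟨h, hv'⟩ := hR.1 v
    refine ⟨h, ?_⟩
    change T ⟨R v, h⟩ - w • R v = y
    rw [← h1, ← sub_eq_zero]
    nth_rewrite 3 [← hv']
    module
  · have h1 : T x - w • (x : E) = (u : E →L[ℂ] E) (T x - z • (x : E)) := by
      rw [hu]
      change _ = (T x - z • (x : E)) - (w - z) • R (T x - z • (x : E))
      rw [hR.2 x]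
      module
    have h2 : (↑u⁻¹ * u : E →L[ℂ] E) (T x - z • (x : E)) = T x - z • (x : E) := by simp
    rw [h1]
    change R ((↑u⁻¹ * u : E →L[ℂ] E) (T x - z • (x : E))) = x
    rw [h2, hR.2]

theorem mem_resolventSet_of_surjective {T : E →ₗ.[ℂ] E} {z : ℂ} {C : ℝ}
    (hb : BoundedBelow T z C) (hs : ∀ y, ∃ x : T.domain, T x - z • (x : E) = y) :
    z ∈ resolventSet T := by
  let A : T.domain →ₗ[ℂ] E := T.toFun - z • T.domain.subtype
  have hbij : Function.Bijective A := by
    refine ⟨(injective_iff_map_eq_zero A).2 fun x hx => ?_, hs⟩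
    exact Subtype.ext (hb.eq_zero x (sub_eq_zero.1 hx))
  let e := LinearEquiv.ofBijective A hbij
  have he : ∀ x : T.domain, e x = T x - z • (x : E) := fun x => rfl
  refine ⟨(T.domain.subtype ∘ₗ e.symm.toLinearMap).mkContinuous C fun y => ?_, fun y => ?_,
    fun x => ?_⟩
  · obtain ⟨x, rfl⟩ := e.surjective y
    simp only [LinearMap.comp_apply, LinearEquiv.coe_coe, e.symm_apply_apply]
    exact hb x
  · obtain ⟨x, rfl⟩ := e.surjective y
    simp only [LinearMap.mkContinuous_apply, LinearMap.comp_apply, LinearEquiv.coe_coe,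
      e.symm_apply_apply]
    exact ⟨x.2, rfl⟩
  · simp [← he]

variable [CompleteSpace E]

theorem mem_resolventBound_of_perturb {T : E →ₗ.[ℂ] E} {z w : ℂ} {C : ℝ} (hC : 0 ≤ C)
    (h : z ∈ resolventBound T C) (hw : C * ‖w - z‖ ≤ 1 / 2) : w ∈ resolventBound T (2 * C) := by
  obtain ⟨⟨R, hR⟩, hb⟩ := h
  refine ⟨⟨_, hR.of_isUnit (isUnit_one_sub_of_norm_lt_one ?_)⟩, hb.perturb hC hw⟩
  rw [norm_smul]
  nlinarith [hR.norm_le hC hb, norm_nonneg (w - z)]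

theorem exists_eventually_mem_resolventBound {T : E →ₗ.[ℂ] E} {z : ℂ} (hz : z ∈ resolventSet T) :
    ∃ C, ∀ᶠ w in 𝓝 z, w ∈ resolventBound T C := by
  obtain ⟨R, hR⟩ := hz
  refine ⟨2 * ‖R‖, ?_⟩
  have : Tendsto (fun w => ‖R‖ * ‖w - z‖) (𝓝 z) (𝓝 (‖R‖ * ‖z - z‖)) :=
    Continuous.tendsto (by fun_prop) z
  simp only [sub_self, norm_zero, mul_zero] at this
  filter_upwards [this.eventually_le_const (by norm_num : (0 : ℝ) < 1 / 2)] with w hw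
  exact mem_resolventBound_of_perturb (norm_nonneg R) ⟨⟨R, hR⟩, hR.boundedBelow⟩ hw

theorem isOpen_resolventSet (T : E →ₗ.[ℂ] E) : IsOpen (resolventSet T) :=
  isOpen_iff_mem_nhds.2 fun _ hz =>
    let ⟨_, h⟩ := exists_eventually_mem_resolventBound hz
    h.mono fun _ hw => hw.1

theorem differentiableAt_resolvent {T : E →ₗ.[ℂ] E} {z : ℂ} (hz : z ∈ resolventSet T) :
    DifferentiableAt ℂ (resolvent T) z := by
  have hR := isResolventAt_resolvent hz
  set R := resolvent T z
  have hg : DifferentiableAt ℂ (fun w : ℂ => 1 - (w - z) • R) z := by fun_prop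
  have h1 : DifferentiableAt ℂ (fun w => Ring.inverse (1 - (w - z) • R)) z :=
    DifferentiableAt.comp (g := Ring.inverse) z (differentiableAt_inverse (by simp)) hg
  refine (h1.const_mul R).congr_of_eventuallyEq ?_
  have : ∀ᶠ w in 𝓝 z, IsUnit (1 - (w - z) • R) :=
    hg.continuousAt.eventually (by
      beta_reduce
      rw [sub_self, zero_smul, sub_zero]
      exact Units.isOpen.mem_nhds (isUnit_one (M := E →L[ℂ] E)))
  filter_upwards [this] with w hw
  have h := hR.of_isUnit hw
  exact (isResolventAt_resolvent ⟨_, h⟩).unique h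

/-- Maximum principle for the resolvent. -/
theorem mem_resolventBound_of_sphere {T : E →ₗ.[ℂ] E} {z : ℂ} {r C : ℝ} (hr : 0 < r) (hC : 0 ≤ C)
    (h : Metric.closedBall z r ⊆ resolventSet T) (hs : Metric.sphere z r ⊆ resolventBound T C) :
    z ∈ resolventBound T C := by
  have hz := h (Metric.mem_closedBall_self hr.le)
  refine ⟨hz, (isResolventAt_resolvent hz).boundedBelow.mono ?_⟩
  refine Complex.norm_le_of_forall_mem_frontier_norm_le (f := resolvent T) Metric.isBounded_ball
    (DifferentiableOn.diffContOnCl fun w hw => (differentiableAt_resolvent (h ?_)).differentiableWithinAt)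
    (fun w hw => ?_) (subset_closure (Metric.mem_ball_self hr))
  · exact Metric.closure_ball_subset_closedBall hw
  · rw [frontier_ball z hr.ne'] at hw
    exact (isResolventAt_resolvent (hs hw).1).norm_le hC (hs hw).2

theorem isClosed_range_sub {T : E →ₗ.[ℂ] E} (hT : T.IsClosed) {z : ℂ} {C : ℝ} (hC : 0 ≤ C)
    (hb : BoundedBelow T z C) : IsClosed {y | ∃ x : T.domain, T x - z • (x : E) = y} := by
  have : CompleteSpace T.graph := (show IsClosed (T.graph : Set (E × E)) from hT).completeSpace_coe
  let g : T.graph →L[ℂ] E :=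
    (ContinuousLinearMap.snd ℂ E E - z • ContinuousLinearMap.fst ℂ E E) ∘L T.graph.subtypeL
  -- The graph carries the max norm: `C` controls `‖x‖`, `1 + ‖z‖ * C` controls `‖T x‖`, and the sum
  -- dominates both.
  have hg : AntilipschitzWith (Real.toNNReal (C + (1 + ‖z‖ * C))) g := by
    refine g.antilipschitz_of_bound fun p => ?_
    obtain ⟨⟨a, b⟩, hp⟩ := p
    obtain ⟨x, hx, hy⟩ := T.mem_graph_iff.1 hp
    simp only at hx hy
    subst hx hy
    rw [Real.coe_toNNReal _ (by positivity)]
    change ‖((x : E), T x)‖ ≤ _ * ‖T x - z • (x : E)‖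
    have h1 : ‖T x‖ ≤ ‖T x - z • (x : E)‖ + ‖z‖ * ‖(x : E)‖ := by
      rw [← norm_smul]
      simpa using norm_add_le (T x - z • (x : E)) (z • (x : E))
    have h2 := hb x
    have h3 := mul_le_mul_of_nonneg_left h2 (norm_nonneg z)
    have h4 : 0 ≤ ‖z‖ * C := by positivity
    have h5 := norm_nonneg (T x - z • (x : E))
    refine max_le ?_ ?_ <;> simp only <;> nlinarith [norm_nonneg (x : E)]
  convert hg.isClosed_range g.uniformContinuous using 1
  ext y
  constructor
  · rintro ⟨x, rfl⟩
    exact ⟨⟨(x, T x), T.mem_graph x⟩, rfl⟩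
  · rintro ⟨⟨⟨a, b⟩, hp⟩, rfl⟩
    obtain ⟨x, hx, hy⟩ := T.mem_graph_iff.1 hp
    simp only at hx hy
    subst hx hy
    exact ⟨x, rfl⟩

/-- A vector orthogonal to the range of `T - z` is an eigenvector of the adjoint. -/
theorem exists_adjoint_eq_of_orthogonal {T : E →ₗ.[ℂ] E} (hd : Dense (T.domain : Set E)) {z : ℂ}
    {v : E} (hv : ∀ x : T.domain, inner ℂ v (T x - z • (x : E)) = 0) :
    ∃ h : v ∈ T.adjoint.domain, T.adjoint ⟨v, h⟩ = (starRingEnd ℂ) z • v := by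
  have h1 : ∀ x : T.domain, inner ℂ ((starRingEnd ℂ) z • v) (x : E) = inner ℂ v (T x) := by
    intro x
    have := hv x
    rw [inner_sub_right, inner_smul_right, sub_eq_zero] at this
    rw [this, inner_smul_left]
    simp
  have h : v ∈ T.adjoint.domain := T.mem_adjoint_domain_of_exists v ⟨_, h1⟩
  exact ⟨h, LinearPMap.adjoint_apply_eq hd _ h1⟩

/-- The first bound makes `T - z` injective with closed range. The second kills the orthogonal
complement of the range, which lies in the kernel of `T* - conj z`. -/
theorem mem_resolventSet_of_boundedBelow_adjoint {T : E →ₗ.[ℂ] E} (hT : T.IsClosed)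
    (hd : Dense (T.domain : Set E)) {z : ℂ} {C D : ℝ} (hC : 0 ≤ C) (hb : BoundedBelow T z C)
    (hb' : BoundedBelow T.adjoint ((starRingEnd ℂ) z) D) : z ∈ resolventSet T := by
  refine mem_resolventSet_of_surjective hb ?_
  let A : T.domain →ₗ[ℂ] E := T.toFun - z • T.domain.subtype
  have hA : (LinearMap.range A : Set E) = {y | ∃ x : T.domain, T x - z • (x : E) = y} := rfl
  have hcl : IsClosed (LinearMap.range A : Set E) := hA ▸ isClosed_range_sub hT hC hb
  have : CompleteSpace (LinearMap.range A) := hcl.completeSpace_coe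
  have htop : LinearMap.range A = ⊤ := by
    rw [← Submodule.orthogonal_eq_bot_iff, Submodule.eq_bot_iff]
    intro v hv
    obtain ⟨h, h'⟩ := exists_adjoint_eq_of_orthogonal hd (z := z) (v := v) fun x =>
      (Submodule.mem_orthogonal' _ _).1 hv _ ⟨x, rfl⟩
    exact hb'.eq_zero ⟨v, h⟩ h'
  exact LinearMap.range_eq_top.1 htop

theorem IsResolventAt.adjoint {T : E →ₗ.[ℂ] E} (hd : Dense (T.domain : Set E)) {z : ℂ}
    {R : E →L[ℂ] E} (hR : IsResolventAt T z R) :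
    IsResolventAt T.adjoint ((starRingEnd ℂ) z) (ContinuousLinearMap.adjoint R) := by
  refine ⟨fun y => ?_, fun x => ext_inner_right ℂ fun v => ?_⟩
  · have h1 : ∀ x : T.domain, inner ℂ (y + (starRingEnd ℂ) z • ContinuousLinearMap.adjoint R y)
        (x : E) = inner ℂ (ContinuousLinearMap.adjoint R y) (T x) := by
      intro x
      have h2 := hR.2 x
      have h3 : R (T x) = x + z • R x := by
        rw [map_sub, map_smul] at h2
        exact sub_eq_iff_eq_add.1 h2
      rw [ContinuousLinearMap.adjoint_inner_left, h3, inner_add_left, inner_smul_left,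
        ContinuousLinearMap.adjoint_inner_left, inner_add_right, inner_smul_right]
      simp
    have h : ContinuousLinearMap.adjoint R y ∈ T.adjoint.domain :=
      T.mem_adjoint_domain_of_exists _ ⟨_, h1⟩
    refine ⟨h, ?_⟩
    rw [LinearPMap.adjoint_apply_eq hd ⟨_, h⟩ h1]
    simp
  · obtain ⟨h, hv⟩ := hR.1 v
    have := LinearPMap.adjoint_isFormalAdjoint hd x ⟨R v, h⟩
    rw [ContinuousLinearMap.adjoint_inner_left, inner_sub_left, this, inner_smul_left]
    simp only [RingHomCompTriple.comp_apply, RingHom.id_apply]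
    rw [← inner_smul_right, ← inner_sub_right, hv]

theorem conj_mem_resolventSet_adjoint {T : E →ₗ.[ℂ] E} (hd : Dense (T.domain : Set E)) {z : ℂ}
    (hz : z ∈ resolventSet T) : (starRingEnd ℂ) z ∈ resolventSet T.adjoint :=
  let ⟨_, hR⟩ := hz
  ⟨_, hR.adjoint hd⟩

/-- Schauder's theorem in Hilbert spaces. -/
theorem isCompactOperator_adjoint {R : E →L[ℂ] E} (hR : IsCompactOperator R) :
    IsCompactOperator (ContinuousLinearMap.adjoint R) := by
  set S := ContinuousLinearMap.adjoint R with hS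
  have hRS : IsCompactOperator (R ∘ S) := hR.comp_clm S
  have hc : IsCompact (closure ((R ∘L S) '' Metric.ball 0 1)) :=
    (isCompactOperator_iff_isCompact_closure_image_ball (R ∘L S : E →ₗ[ℂ] E) one_pos).1 hRS
  have htb := hc.totallyBounded.subset subset_closure
  refine (isCompactOperator_iff_isCompact_closure_image_ball (S : E →ₗ[ℂ] E) one_pos).2 ?_
  refine TotallyBounded.isCompact_of_isClosed (TotallyBounded.closure ?_) isClosed_closure
  refine Metric.totallyBounded_iff.2 fun ε hε => ?_
  -- Since `‖S d‖² ≤ ‖R S d‖ ‖d‖` and differences in the unit ball have norm below `2`, an `ε² /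
  -- 2`-net for the image under `R S` yields an `ε`-net for the image under `S`.
  obtain ⟨t, ht, htf, hcov⟩ := Metric.finite_approx_of_totallyBounded htb (ε ^ 2 / 2) (by positivity)
  obtain ⟨t', ht', htf', rfl⟩ := (Set.exists_subset_image_finite_and (p := fun s => s = t)).1
    ⟨t, ht, htf, rfl⟩
  refine ⟨S '' t', htf'.image _, ?_⟩
  rintro _ ⟨x, hx, rfl⟩
  obtain ⟨_, ⟨x', hx', rfl⟩, hxx'⟩ := Set.mem_iUnion₂.1 (hcov ⟨x, hx, rfl⟩)
  refine Set.mem_iUnion₂.2 ⟨S x', ⟨x', hx', rfl⟩, ?_⟩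
  rw [Metric.mem_ball, dist_eq_norm, ← map_sub] at hxx'
  rw [Metric.mem_ball, dist_eq_norm]
  change ‖S x - S x'‖ < ε
  rw [← map_sub]
  have hd : ‖x - x'‖ < 2 := by
    have h1 := mem_ball_zero_iff.1 hx
    have h2 := mem_ball_zero_iff.1 (ht' hx')
    linarith [norm_sub_le x x']
  have h1 : ‖S (x - x')‖ ^ 2 ≤ ‖(R ∘L S) (x - x')‖ * ‖x - x'‖ := by
    rw [← inner_self_eq_norm_sq (𝕜 := ℂ)]
    nth_rewrite 2 [hS]
    rw [ContinuousLinearMap.adjoint_inner_right]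
    exact (RCLike.re_le_norm _).trans (norm_inner_le_norm _ _)
  have h2 := mul_lt_mul'' hxx' hd (norm_nonneg _) (norm_nonneg _)
  exact lt_of_pow_lt_pow_left₀ 2 hε.le (by linarith)

/-- For `w ≠ z`, `1 - (w - z) R` fails to be invertible only if `R*` has the eigenvalue `conj (w -
z)⁻¹`. Its eigenvectors are orthogonal to the range of `T - w`, hence in the kernel of `T* - conj
w`, which the lower bound makes trivial. -/
theorem mem_resolventSet_of_isCompactOperator {T : E →ₗ.[ℂ] E} (hd : Dense (T.domain : Set E))
    (hc : HasCompactResolvent T) {w : ℂ} {C : ℝ}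
    (hb : BoundedBelow T.adjoint ((starRingEnd ℂ) w) C) : w ∈ resolventSet T := by
  obtain ⟨z, hz, hc⟩ := hc
  have hR := isResolventAt_resolvent hz
  set R := resolvent T z
  rcases eq_or_ne w z with rfl | hwz
  · exact hz
  refine ⟨_, hR.of_isUnit ?_⟩
  have hwz' : w - z ≠ 0 := sub_ne_zero.2 hwz
  have hμ : (w - z)⁻¹ ≠ 0 := inv_ne_zero hwz'
  rcases (isCompactOperator_adjoint hc).hasEigenvalue_or_mem_resolventSet
    (star_ne_zero.2 hμ) with h | h
  · obtain ⟨v, hv⟩ := h.exists_hasEigenvector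
    refine absurd ?_ hv.2
    have hv' : ContinuousLinearMap.adjoint R v = star (w - z)⁻¹ • v := hv.apply_eq_smul
    obtain ⟨h1, h2⟩ := exists_adjoint_eq_of_orthogonal hd (z := w) (v := v) fun x => by
      have h3 : T x - w • (x : E) = (T x - z • (x : E)) - (w - z) • (x : E) := by module
      have h4 : inner ℂ v (x : E) = (w - z)⁻¹ * inner ℂ v (T x - z • (x : E)) := by
        conv_lhs => rw [← hR.2 x, ← ContinuousLinearMap.adjoint_inner_left, hv', inner_smul_left,
          ← starRingEnd_apply, Complex.conj_conj]
      rw [h3, inner_sub_right, inner_smul_right, h4, mul_inv_cancel_left₀ hwz', sub_self]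
    exact hb.eq_zero ⟨v, h1⟩ h2
  · have h1 := spectrum.mem_resolventSet_iff.1 (spectrum.star_mem_resolventSet_iff.1 h)
    have h2 : 1 - (w - z) • R =
        algebraMap ℂ (E →L[ℂ] E) (w - z) * (algebraMap ℂ _ (w - z)⁻¹ - R) := by
      rw [mul_sub, ← map_mul, mul_inv_cancel₀ hwz', map_one, Algebra.smul_def]
    rw [← ContinuousLinearMap.star_eq_adjoint, star_star] at h1
    rw [h2]
    exact ((isUnit_iff_ne_zero.2 hwz').map (algebraMap ℂ (E →L[ℂ] E))).mul h1

/-- The constant is preserved because `‖R‖ = ‖R*‖`. -/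
theorem mem_resolventBound_of_adjoint {T : E →ₗ.[ℂ] E} (hd : Dense (T.domain : Set E)) {w : ℂ}
    {C : ℝ} (hC : 0 ≤ C) (hw : w ∈ resolventSet T)
    (hb : BoundedBelow T.adjoint ((starRingEnd ℂ) w) C) : w ∈ resolventBound T C := by
  obtain ⟨R, hR⟩ := hw
  refine ⟨⟨R, hR⟩, hR.boundedBelow.mono ?_⟩
  rw [← LinearIsometryEquiv.norm_map ContinuousLinearMap.adjoint R]
  exact (hR.adjoint hd).norm_le hC hb

end BoundedBelow

/-! ### Limiting essential spectra and lower bounds under strong resolvent convergence. -/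

section Convergence

variable {H₀ : Type*} [NormedAddCommGroup H₀] [InnerProductSpace ℂ H₀] {Hn : ℕ → Submodule ℂ H₀}

theorem neBot_atTop_inf_principal {I : Set ℕ} (hI : I.Infinite) : (atTop ⊓ 𝓟 I).NeBot :=
  frequently_iff_neBot.1 (Nat.frequently_atTop_iff_infinite.2 hI)

/-- Vectors found along a subsequence must be completed to a family over all indices, in spaces that
vary with the index. -/
theorem exists_extension_of_injective {ι κ : Type*} {X : κ → Type*} [∀ k, Nonempty (X k)]
    {φ : ι → κ} (hφ : Function.Injective φ) (x : ∀ i, X (φ i)) :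
    ∃ x' : ∀ k, X k, ∀ i, x' (φ i) = x i := by
  have : ∀ k, ∃ a : X k, ∀ i (h : φ i = k), h ▸ x i = a := by
    intro k
    by_cases hk : ∃ i, φ i = k
    · obtain ⟨i, rfl⟩ := hk
      refine ⟨x i, fun j h => ?_⟩
      obtain rfl := hφ h
      rfl
    · exact ⟨Classical.arbitrary _, fun i h => absurd ⟨i, h⟩ hk⟩
  choose x' hx' using this
  exact ⟨x', fun i => (hx' _ i rfl).symm⟩

theorem mem_limitingEssSpectrum_of_seq {Tn : ∀ n, Hn n →ₗ.[ℂ] Hn n} {z : ℂ} {φ : ℕ → ℕ}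
    (hφ : StrictMono φ) (x : ∀ m, (Tn (φ m)).domain)
    (hx : ∀ m, ‖((x m : Hn (φ m)) : H₀)‖ = 1)
    (hw : ∀ y : H₀, Tendsto (fun m => inner ℂ y ((x m : Hn (φ m)) : H₀)) atTop (𝓝 0))
    (ht : Tendsto (fun m => ‖Tn (φ m) (x m) - z • (x m : Hn (φ m))‖) atTop (𝓝 0)) :
    z ∈ limitingEssSpectrum Tn := by
  obtain ⟨x', hx'⟩ := exists_extension_of_injective (X := fun n => (Tn n).domain) hφ.injective x
  have hmap : atTop ⊓ 𝓟 (Set.range φ) = map φ atTop := by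
    have h : comap φ atTop = atTop := comap_embedding_atTop (fun _ _ => hφ.le_iff_le)
      fun c => ⟨c, hφ.le_apply⟩
    rw [← map_comap, h]
  refine ⟨Set.range φ, x', Set.infinite_range_of_injective hφ.injective, ?_, fun y => ?_, ?_⟩
  · rintro _ ⟨m, rfl⟩
    rw [hx', hx]
  · rw [hmap, tendsto_map'_iff]
    simpa only [Function.comp_def, hx'] using hw y
  · rw [hmap, tendsto_map'_iff]
    simpa only [Function.comp_def, hx'] using ht

/-- A diagonal argument: for unit vectors, weak convergence to `0` need only be tested on a
countable dense set, so the `m`-th vector has to meet only finitely many conditions. -/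
theorem isClosed_limitingEssSpectrum [TopologicalSpace.SeparableSpace H₀]
    (Tn : ∀ n, Hn n →ₗ.[ℂ] Hn n) : IsClosed (limitingEssSpectrum Tn) := by
  refine isClosed_of_closure_subset fun z hz => ?_
  let y := TopologicalSpace.denseSeq H₀
  have key : ∀ m : ℕ, ∃ᶠ n in atTop, ∃ x : (Tn n).domain, ‖((x : Hn n) : H₀)‖ = 1 ∧
      (∀ k ≤ m, ‖(inner ℂ (y k) ((x : Hn n) : H₀) : ℂ)‖ < 1 / ((m : ℝ) + 1)) ∧
      ‖Tn n x - z • (x : Hn n)‖ < 1 / ((m : ℝ) + 1) := by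
    intro m
    -- Half of the tolerance pays for replacing `z` by a nearby `w` in the set, half for the
    -- residual at `w`.
    have hm : 0 < 1 / ((m : ℝ) + 1) / 2 := by positivity
    obtain ⟨w, ⟨I, x, hI, hx, hxw, hxt⟩, hwz⟩ := Metric.mem_closure_iff.1 hz _ hm
    have := neBot_atTop_inf_principal hI
    have h1 : ∀ᶠ n in atTop ⊓ 𝓟 I, ∀ k ∈ Finset.range (m + 1),
        ‖(inner ℂ (y k) ((x n : Hn n) : H₀) : ℂ)‖ < 1 / ((m : ℝ) + 1) :=
      (eventually_all_finset _).2 fun k _ =>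
        (tendsto_zero_iff_norm_tendsto_zero.1 (hxw (y k))).eventually_lt_const (by positivity)
    have h2 := hxt.eventually_lt_const hm
    have h3 : ∀ᶠ n in atTop ⊓ 𝓟 I, n ∈ I := eventually_inf_principal.2 (by simp)
    refine Frequently.filter_mono (f := atTop ⊓ 𝓟 I) (Eventually.frequently ?_) inf_le_left
    filter_upwards [h1, h2, h3] with n h1 h2 h3
    refine ⟨x n, hx n h3, fun k hk => h1 k (Finset.mem_range.2 (by omega)), ?_⟩
    have h4 : Tn n (x n) - z • (x n : Hn n) =
      (Tn n (x n) - w • (x n : Hn n)) - (z - w) • (x n : Hn n) := by module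
    have h5 : ‖(x n : Hn n)‖ = 1 := hx n h3
    rw [h4]
    refine (norm_sub_le _ _).trans_lt ?_
    rw [norm_smul, h5, mul_one, ← dist_eq_norm z w]
    linarith
  obtain ⟨φ, hφ, h⟩ := extraction_forall_of_frequently key
  choose x hx hxw hxt using h
  refine mem_limitingEssSpectrum_of_seq hφ x hx (fun v => ?_)
    (squeeze_zero (fun _ => norm_nonneg _) (fun m => (hxt m).le) tendsto_one_div_add_atTop_nhds_zero_nat)
  refine Metric.tendsto_nhds.2 fun ε hε => ?_
  obtain ⟨_, ⟨k, rfl⟩, hk⟩ := Metric.mem_closure_iff.1 (TopologicalSpace.denseRange_denseSeq H₀ v)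
    (ε / 2) (half_pos hε)
  filter_upwards [eventually_ge_atTop k, (tendsto_one_div_add_atTop_nhds_zero_nat
    (𝕜 := ℝ)).eventually_lt_const (half_pos hε)] with m hm hm'
  rw [dist_zero_right]
  have h1 : inner ℂ v ((x m : Hn (φ m)) : H₀) = inner ℂ (v - y k) ((x m : Hn (φ m)) : H₀) +
      inner ℂ (y k) ((x m : Hn (φ m)) : H₀) := by rw [inner_sub_left, sub_add_cancel]
  have h2 := norm_inner_le_norm (𝕜 := ℂ) (v - y k) ((x m : Hn (φ m)) : H₀)
  rw [hx m, mul_one, ← dist_eq_norm] at h2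
  rw [h1]
  refine (norm_add_le _ _).trans_lt ?_
  have h3 := hxw m k hm
  change dist v (y k) < _ at hk
  linarith

variable [∀ n, (Hn n).HasOrthogonalProjection] {H : Submodule ℂ H₀} [H.HasOrthogonalProjection]

/-- If `Bₙ` converges to `B` and `w ∈ ρ(B)`, the formal adjoints `Aₙ` of `Bₙ` are uniformly bounded
below at `conj w` unless `conj w` is in their limiting essential spectrum. -/
theorem exists_eventually_boundedBelow {An Bn : ∀ n, Hn n →ₗ.[ℂ] Hn n} {B : H →ₗ.[ℂ] H}
    (hAB : ∀ n, (An n).IsFormalAdjoint (Bn n)) (hB : ConvergesGSR Bn B) {w : ℂ}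
    (hw : w ∈ resolventSet B) (hess : (starRingEnd ℂ) w ∉ limitingEssSpectrum An) :
    ∃ C, 0 ≤ C ∧ ∀ᶠ n in atTop, BoundedBelow (An n) ((starRingEnd ℂ) w) C := by
  by_contra! hcon
  refine hess ?_
  have key : ∀ m : ℕ, ∃ᶠ n in atTop, ∃ x : (An n).domain, ‖((x : Hn n) : H₀)‖ = 1 ∧
      ‖An n x - (starRingEnd ℂ) w • (x : Hn n)‖ ≤ 1 / ((m : ℝ) + 1) := by
    intro m
    refine (hcon ((m : ℝ) + 1) (by positivity)).mono fun n hn => ?_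
    simp only [BoundedBelow, not_forall, not_le] at hn
    obtain ⟨x, hx⟩ := hn
    have hx0 : 0 < ‖(x : Hn n)‖ := lt_of_le_of_lt (by positivity) hx
    have hc : ‖(‖(x : Hn n)‖⁻¹ : ℂ)‖ = ‖(x : Hn n)‖⁻¹ := by simp
    refine ⟨(‖(x : Hn n)‖⁻¹ : ℂ) • x, ?_, ?_⟩
    · change ‖(‖(x : Hn n)‖⁻¹ : ℂ) • (x : Hn n)‖ = 1
      rw [norm_smul, hc, inv_mul_cancel₀ hx0.ne']
    · rw [LinearPMap.map_smul, Submodule.coe_smul, smul_comm, ← smul_sub, norm_smul, hc,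
        inv_mul_le_iff₀ hx0, mul_one_div, le_div_iff₀ (by positivity)]
      linarith
  obtain ⟨φ, hφ, h⟩ := extraction_forall_of_frequently key
  choose x hx hxt using h
  have ht := squeeze_zero (fun _ => norm_nonneg _) hxt tendsto_one_div_add_atTop_nhds_zero_nat
  refine mem_limitingEssSpectrum_of_seq hφ x hx (fun v => ?_) ht
  obtain ⟨n₀, μ, hμn, hμ, hlim⟩ := hB
  obtain ⟨hu, hu'⟩ := (isResolventAt_resolvent hw).1 (H.orthogonalProjectionOnto v)
  set u := resolvent B w (H.orthogonalProjectionOnto v)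
  -- With `u = (B - w)⁻¹ P v`, this choice gives `P y = (B - μ) u`. Convergence at the single point
  -- `μ` then suffices to approximate `u` by `b m ∈ dom (Bn (φ m))`.
  set y : H₀ := v + (w - μ) • (u : H₀) with hy
  have hRy : resolvent B μ (H.orthogonalProjectionOnto y) = u := by
    have h1 : H.orthogonalProjectionOnto y = B ⟨u, hu⟩ - μ • u := by
      rw [hy, map_add, map_smul, Submodule.orthogonalProjectionOnto_mem_subspace_eq_self, ← hu']
      module
    rw [h1]
    exact (isResolventAt_resolvent hμ).2 ⟨u, hu⟩
  have hb := (hlim y).comp hφ.tendsto_atTop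
  rw [hRy] at hb
  set b : ℕ → H₀ := (fun n => (resolvent (Bn n) μ ((Hn n).orthogonalProjectionOnto y) : H₀)) ∘ φ
  have hb2 : Tendsto (fun m => ‖An (φ m) (x m) - (starRingEnd ℂ) w • (x m : Hn (φ m))‖ * ‖b m‖ +
      ‖w - μ‖ * ‖b m - u‖) atTop (𝓝 0) := by
    have := (ht.mul hb.norm).add ((hb.sub_const (u : H₀)).norm.const_mul ‖w - μ‖)
    simpa using this
  refine squeeze_zero_norm' ?_ hb2
  filter_upwards [hφ.tendsto_atTop.eventually_ge_atTop n₀] with m hm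
  rw [norm_inner_symm]
  obtain ⟨hd, hd'⟩ := (isResolventAt_resolvent (hμn _ hm)).1
    ((Hn (φ m)).orthogonalProjectionOnto y)
  set r := resolvent (Bn (φ m)) μ ((Hn (φ m)).orthogonalProjectionOnto y)
  have hbr : b m = r := rfl
  have h1 : inner ℂ ((x m : Hn (φ m)) : H₀) y = inner ℂ
      (An (φ m) (x m) - (starRingEnd ℂ) w • (x m : Hn (φ m))) r +
      (w - μ) * inner ℂ (x m : Hn (φ m)) r := by
    have h2 := hAB (φ m) (x m) ⟨r, hd⟩
    rw [← Submodule.inner_orthogonalProjectionOnto_eq_of_mem_left, ← hd', inner_sub_left,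
      inner_sub_right, h2, inner_smul_left, inner_smul_right, Complex.conj_conj]
    ring
  -- The first term vanishes in the limit because the residual of `x m` does and `b m` is bounded,
  -- the second because `b m → u`.
  have h3 : inner ℂ ((x m : Hn (φ m)) : H₀) v = inner ℂ
      (An (φ m) (x m) - (starRingEnd ℂ) w • (x m : Hn (φ m))) r +
      (w - μ) * inner ℂ ((x m : Hn (φ m)) : H₀) (b m - u) := by
    have h4 : v = y - (w - μ) • (u : H₀) := by rw [hy, add_sub_cancel_right]
    rw [h4, inner_sub_right, h1, inner_smul_right, inner_sub_right, hbr,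
      Submodule.coe_inner _ (x m : Hn (φ m)) r]
    ring
  rw [h3]
  refine (norm_add_le _ _).trans (add_le_add (norm_inner_le_norm _ _) ?_)
  rw [norm_mul]
  gcongr
  simpa only [hx m, one_mul] using norm_inner_le_norm (𝕜 := ℂ) ((x m : Hn (φ m)) : H₀) (b m - u)

/-- For `y = (T - z) x`, the vectors `xₙ = (Tn n - z)⁻¹ Pₙ y` converge to `x`, and `(Tn n - w) xₙ =
Pₙ y + (z - w) xₙ` converges to `(T - w) x`. The inequality passes to the limit even if it holds
only for infinitely many `n`. -/
theorem ConvergesGSR.boundedBelow {Tn : ∀ n, Hn n →ₗ.[ℂ] Hn n} {T : H →ₗ.[ℂ] H}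
    (hP : ∀ x : H₀, Tendsto (fun n => ((Hn n).orthogonalProjectionOnto x : H₀)) atTop
      (𝓝 (H.orthogonalProjectionOnto x : H₀))) (hT : ConvergesGSR Tn T) {w : ℂ} {C : ℝ}
    (hb : ∃ᶠ n in atTop, BoundedBelow (Tn n) w C) : BoundedBelow T w C := by
  intro x
  obtain ⟨n₀, z, hzn, hz, hlim⟩ := hT
  set y : H := T x - z • (x : H) with hy
  have h1 := hlim y
  have h2 := hP y
  rw [Submodule.orthogonalProjectionOnto_mem_subspace_eq_self] at h1 h2
  rw [(isResolventAt_resolvent hz).2 x] at h1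
  have h3 := ((h2.add (h1.const_smul (z - w))).norm).const_mul C
  have h4 : T x - w • (x : H) = y + (z - w) • (x : H) := by rw [hy]; module
  rw [h4]
  refine le_of_tendsto_of_tendsto_of_frequently h1.norm h3 ?_
  refine (hb.and_eventually (eventually_ge_atTop n₀)).mono fun n ⟨hn, hn₀⟩ => ?_
  obtain ⟨hd, hd'⟩ := (isResolventAt_resolvent (hzn n hn₀)).1 ((Hn n).orthogonalProjectionOnto y)
  have h5 := hn ⟨_, hd⟩
  have h6 : Tn n ⟨_, hd⟩ - w • resolvent (Tn n) z ((Hn n).orthogonalProjectionOnto y) =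
      (Hn n).orthogonalProjectionOnto y +
        (z - w) • resolvent (Tn n) z ((Hn n).orthogonalProjectionOnto y) := by
    rw [sub_eq_iff_eq_add.1 hd']
    module
  simp only [h6] at h5
  exact h5

end Convergence

/-! ### Uniform resolvent bounds and their consequences for the spectra. -/

section Stability

variable {H₀ : Type*} [NormedAddCommGroup H₀] [InnerProductSpace ℂ H₀] {Hn : ℕ → Submodule ℂ H₀}
  {H : Submodule ℂ H₀}

/-- The points at which the resolvents of `Tₙ` eventually exist and are uniformly bounded. -/
def regionOfBoundedness (Tn : ∀ n, Hn n →ₗ.[ℂ] Hn n) : Set ℂ :=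
  {z | ∃ C, 0 ≤ C ∧ ∀ᶠ n in atTop, z ∈ resolventBound (Tn n) C}

/-- The radius of the Neumann series depends only on the bound `C`, so one neighbourhood serves all
large `n`. -/
theorem eventually_nhds_resolventBound [∀ n, CompleteSpace (Hn n)]
    {Tn : ∀ n, Hn n →ₗ.[ℂ] Hn n} {z : ℂ} (hz : z ∈ regionOfBoundedness Tn) :
    ∃ C, 0 ≤ C ∧ ∃ U ∈ 𝓝 z, ∀ᶠ n in atTop, U ⊆ resolventBound (Tn n) C := by
  obtain ⟨C, hC, h⟩ := hz
  have hU : {w | C * ‖w - z‖ < 1 / 2} ∈ 𝓝 z :=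
    (isOpen_lt (by fun_prop) continuous_const).mem_nhds (by simp)
  refine ⟨2 * C, by positivity, _, hU, h.mono fun n hn w hw => ?_⟩
  exact mem_resolventBound_of_perturb hC hn (le_of_lt hw)

theorem exists_resolventBound_of_isCompact [∀ n, CompleteSpace (Hn n)]
    {Tn : ∀ n, Hn n →ₗ.[ℂ] Hn n} {K : Set ℂ} (hK : IsCompact K)
    (h : K ⊆ regionOfBoundedness Tn) :
    ∃ C, 0 ≤ C ∧ ∀ᶠ n in atTop, K ⊆ resolventBound (Tn n) C := by
  refine hK.induction_on (p := fun K => ∃ C, 0 ≤ C ∧ ∀ᶠ n in atTop, K ⊆ resolventBound (Tn n) C)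
    ⟨0, le_rfl, by simp⟩ ?_ ?_ fun z hz => ?_
  · rintro s t hst ⟨C, hC, ht⟩
    exact ⟨C, hC, ht.mono fun n hn => hst.trans hn⟩
  · rintro s t ⟨C, hC, hs⟩ ⟨D, hD, ht⟩
    refine ⟨max C D, le_max_of_le_left hC, ?_⟩
    filter_upwards [hs, ht] with n hs ht
    exact Set.union_subset (hs.trans (resolventBound_mono (le_max_left _ _)))
      (ht.trans (resolventBound_mono (le_max_right _ _)))
  · obtain ⟨C, hC, U, hU, hUn⟩ := eventually_nhds_resolventBound (h hz)
    exact ⟨U, mem_nhdsWithin_of_mem_nhds hU, C, hC, hUn⟩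

theorem isLimitOfSpectra_iff {Tn : ∀ n, Hn n →ₗ.[ℂ] Hn n} {z : ℂ} :
    IsLimitOfSpectra Tn z ↔ ∀ δ > 0, ∀ᶠ n in atTop, ∃ w ∈ spectrum (Tn n), dist z w < δ := by
  constructor
  · rintro ⟨w, hw, hwz⟩ δ hδ
    filter_upwards [hw, Metric.tendsto_nhds.1 hwz δ hδ] with n h1 h2
    exact ⟨w n, h1, by rwa [dist_comm]⟩
  · intro h
    -- Almost nearest points are chosen. The value at an empty spectrum is irrelevant, as this
    -- happens for only finitely many `n`.
    have key : ∀ n, ∃ w, (spectrum (Tn n)).Nonempty → w ∈ spectrum (Tn n) ∧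
        dist z w < Metric.infDist z (spectrum (Tn n)) + 1 / ((n : ℝ) + 1) := by
      intro n
      by_cases hn : (spectrum (Tn n)).Nonempty
      · obtain ⟨w, hw⟩ := (Metric.infDist_lt_iff hn (x := z)).1
          (lt_add_of_pos_right _ (by positivity : 0 < 1 / ((n : ℝ) + 1)))
        exact ⟨w, fun _ => hw⟩
      · exact ⟨0, fun h => absurd h hn⟩
    choose w hw using key
    refine ⟨w, (h 1 one_pos).mono fun n ⟨v, hv, _⟩ => (hw n ⟨v, hv⟩).1, ?_⟩
    refine Metric.tendsto_nhds.2 fun ε hε => ?_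
    filter_upwards [h (ε / 2) (half_pos hε), (tendsto_one_div_add_atTop_nhds_zero_nat
      (𝕜 := ℝ)).eventually_lt_const (half_pos hε)] with n ⟨v, hv, hzv⟩ hn
    have h1 := (hw n ⟨v, hv⟩).2
    have h2 := Metric.infDist_le_dist_of_mem hv (x := z)
    rw [dist_comm]
    linarith

theorem not_isSpectralPollution_of_mem_regionOfBoundedness [∀ n, CompleteSpace (Hn n)]
    {Tn : ∀ n, Hn n →ₗ.[ℂ] Hn n} {T : H →ₗ.[ℂ] H} {z : ℂ} (hz : z ∈ regionOfBoundedness Tn) :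
    ¬ IsSpectralPollution Tn T z := by
  rintro ⟨-, I, w, hI, hw, hwz⟩
  have := neBot_atTop_inf_principal hI
  obtain ⟨C, -, U, hU, hUn⟩ := eventually_nhds_resolventBound hz
  have h1 : ∀ᶠ n in atTop ⊓ 𝓟 I, n ∈ I := eventually_inf_principal.2 (by simp)
  obtain ⟨n, h1, h2, h3⟩ := (h1.and ((hwz.eventually hU).and (hUn.filter_mono inf_le_left))).exists
  exact hw n h1 (h3 h2).1

variable [∀ n, CompleteSpace (Hn n)] [CompleteSpace H]

theorem ConvergesGSR.isLimitOfSpectra {Tn : ∀ n, Hn n →ₗ.[ℂ] Hn n} {T : H →ₗ.[ℂ] H}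
    (hP : ∀ x : H₀, Tendsto (fun n => ((Hn n).orthogonalProjectionOnto x : H₀)) atTop
      (𝓝 (H.orthogonalProjectionOnto x : H₀))) (hT : ConvergesGSR Tn T) {z : ℂ}
    (hz : z ∈ spectrum T)
    (hiso : ∀ᶠ w in 𝓝[≠] z, w ∈ resolventSet T ∧ w ∈ regionOfBoundedness Tn) :
    IsLimitOfSpectra Tn z := by
  by_contra hcon
  rw [isLimitOfSpectra_iff] at hcon
  push Not at hcon
  obtain ⟨δ, hδ, hfar⟩ := hcon
  obtain ⟨ε, hε, hball⟩ := Metric.eventually_nhds_iff.1 (eventually_nhdsWithin_iff.1 hiso)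
  have hr : 0 < min ε δ / 2 := by positivity
  -- The circle must stay in the punctured disc supplied by `hiso`, and the closed disc within the
  -- distance `δ` that is free of `σ(Tn n)` for infinitely many `n`.
  set r := min ε δ / 2 with hr_def
  have hrε : r < ε := by linarith [min_le_left ε δ]
  have hrδ : r < δ := by linarith [min_le_right ε δ]
  obtain ⟨C, hC, hs⟩ := exists_resolventBound_of_isCompact (Tn := Tn) (isCompact_sphere z r)
    fun w hw => (hball (hw.trans_lt hrε) (Metric.ne_of_mem_sphere hw hr.ne')).2
  have hb : BoundedBelow T z C := by
    refine hT.boundedBelow hP ((hfar.and_eventually hs).mono fun n ⟨h1, h2⟩ => ?_)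
    refine (mem_resolventBound_of_sphere hr hC (fun w hw => ?_) h2).2
    by_contra hw'
    have := h1 w hw'
    rw [dist_comm] at this
    exact absurd (this.trans hw) (not_le.2 hrδ)
  -- Moving from `z` to `w` doubles the constant, and returning from `w` to `z` needs `2 * C * ‖z -
  -- w‖ ≤ 1 / 2`.
  have hnear : ∀ᶠ w in 𝓝[≠] z, C * ‖w - z‖ < 1 / 4 :=
    mem_nhdsWithin_of_mem_nhds ((isOpen_lt (f := fun w => C * ‖w - z‖) (by fun_prop)
      continuous_const).mem_nhds (by simp))
  obtain ⟨w, hw, hw'⟩ := (hnear.and hiso).exists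
  refine hz (mem_resolventBound_of_perturb (C := 2 * C) (by positivity)
    ⟨hw'.1, hb.perturb hC (by linarith)⟩ ?_).1
  rw [norm_sub_rev]
  linarith

/-- Closedness of `S` keeps a whole neighbourhood of an isolated point outside `S`, so that `hstab`
applies on its punctured part. -/
theorem ConvergesGSR.spectrallyExactOutside {Tn : ∀ n, Hn n →ₗ.[ℂ] Hn n} {T : H →ₗ.[ℂ] H}
    (hP : ∀ x : H₀, Tendsto (fun n => ((Hn n).orthogonalProjectionOnto x : H₀)) atTop
      (𝓝 (H.orthogonalProjectionOnto x : H₀))) (hT : ConvergesGSR Tn T) {S : Set ℂ}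
    (hS : IsClosed S) (hstab : ∀ z ∈ resolventSet T, z ∉ S → z ∈ regionOfBoundedness Tn) :
    SpectrallyExactOutside Tn T S := by
  refine ⟨fun z hz => ?_, fun z hz hiso hzS => hT.isLimitOfSpectra hP hz ?_⟩
  · by_contra hzS
    exact not_isSpectralPollution_of_mem_regionOfBoundedness
      (hstab z (Set.notMem_compl_iff.1 hz.1) hzS) hz
  · filter_upwards [hiso, mem_nhdsWithin_of_mem_nhds (hS.isOpen_compl.mem_nhds hzS)] with w h1 h2
    exact ⟨Set.notMem_compl_iff.1 h1, hstab w (Set.notMem_compl_iff.1 h1) h2⟩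

theorem ConvergesGSR.tendsto_hausdorffEDist {Tn : ∀ n, Hn n →ₗ.[ℂ] Hn n} {T : H →ₗ.[ℂ] H}
    (hP : ∀ x : H₀, Tendsto (fun n => ((Hn n).orthogonalProjectionOnto x : H₀)) atTop
      (𝓝 (H.orthogonalProjectionOnto x : H₀))) (hT : ConvergesGSR Tn T) {K : Set ℂ}
    (hK : IsCompact K) (hd : IsDiscrete (K ∩ spectrum T)) (hint : K ∩ spectrum T ⊆ interior K)
    (hstab : ∀ z ∈ K, z ∈ resolventSet T → z ∈ regionOfBoundedness Tn) :
    Tendsto (fun n => Metric.hausdorffEDist (spectrum (Tn n) ∩ K) (spectrum T ∩ K)) atTop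
      (𝓝 0) := by
  have hcl : IsClosed (spectrum T) := (isOpen_resolventSet T).isClosed_compl
  have hfin : (K ∩ spectrum T).Finite := (hK.inter_right hcl).finite hd
  refine ENNReal.tendsto_nhds_zero.2 fun ε hε => ?_
  have hfar : ∀ᶠ n in atTop, ∀ z ∈ spectrum (Tn n) ∩ K,
      Metric.infEDist z (spectrum T ∩ K) < ε := by
    -- This compact set misses `σ(T)`, so uniform resolvent bounds on it expel `σ(Tn n)` for large
    -- `n`. If `σ(T) ∩ K` is empty the distance is `∞` and the set is all of `K`.
    have hK' : IsCompact (K ∩ {z | ε ≤ Metric.infEDist z (spectrum T ∩ K)}) :=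
      hK.inter_right (isClosed_le continuous_const Metric.continuous_infEDist)
    obtain ⟨C, -, h⟩ := exists_resolventBound_of_isCompact (Tn := Tn) hK' fun z hz =>
      hstab z hz.1 (by
        by_contra hzT
        have h0 := Metric.infEDist_zero_of_mem (show z ∈ spectrum T ∩ K from ⟨hzT, hz.1⟩)
        exact absurd (h0 ▸ hz.2 : ε ≤ 0) (not_le.2 hε))
    filter_upwards [h] with n hn z hz
    by_contra! hlt
    exact hz.1 (hn ⟨hz.2, hlt⟩).1
  have hnear : ∀ᶠ n in atTop, ∀ z ∈ K ∩ spectrum T,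
      ∃ w ∈ spectrum (Tn n) ∩ K, edist z w ≤ ε := by
    refine (eventually_all_finite hfin).2 fun z hz => ?_
    -- Interiority gives control of the resolvents on a full punctured neighbourhood of `z` and puts
    -- the approximating spectral points in `K`.
    have hKz : K ∈ 𝓝 z := mem_interior_iff_mem_nhds.1 (hint hz)
    have hlim : IsLimitOfSpectra Tn z := by
      refine hT.isLimitOfSpectra hP hz.2 ?_
      have h1 : ((K ∩ spectrum T) \ {z})ᶜ ∈ 𝓝 z :=
        (hfin.subset Set.sdiff_subset).isClosed.isOpen_compl.mem_nhds (by simp)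
      filter_upwards [mem_nhdsWithin_of_mem_nhds h1, mem_nhdsWithin_of_mem_nhds hKz,
        self_mem_nhdsWithin] with w h1 h2 h3
      have h4 : w ∈ resolventSet T := by
        by_contra h4
        exact h1 ⟨⟨h2, h4⟩, h3⟩
      exact ⟨h4, hstab w h2 h4⟩
    obtain ⟨w, hw, hwz⟩ := hlim
    filter_upwards [hw, hwz.eventually hKz, hwz.eventually (Metric.closedEBall_mem_nhds z hε)]
      with n h1 h2 h3
    exact ⟨w n, ⟨h1, h2⟩, by rw [edist_comm]; exact h3⟩
  filter_upwards [hfar, hnear] with n h1 h2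
  refine Metric.hausdorffEDist_le_of_infEDist (fun z hz => (h1 z hz).le) fun z hz => ?_
  obtain ⟨w, hw, hzw⟩ := h2 z ⟨hz.2, hz.1⟩
  exact (Metric.infEDist_le_edist_of_mem hw).trans hzw

theorem isClosed_conjSet {S : Set ℂ} (hS : IsClosed S) : IsClosed (conjSet S) :=
  Complex.conjCLE.toHomeomorph.isClosedMap S hS

theorem mem_conjSet_of_conj_mem {S : Set ℂ} {z : ℂ} (h : (starRingEnd ℂ) z ∈ S) :
    z ∈ conjSet S := ⟨_, h, Complex.conj_conj z⟩

variable {T : H →ₗ.[ℂ] H} {Tn : ∀ n, Hn n →ₗ.[ℂ] Hn n}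

theorem ConvergesGSR.exists_boundedBelow_adjoint (hTnd : ∀ n, Dense ((Tn n).domain : Set (Hn n)))
    (hT : ConvergesGSR Tn T) {z : ℂ} (hz : z ∈ resolventSet T)
    (hzS : z ∉ conjSet (limitingEssSpectrum fun n => (Tn n).adjoint)) :
    ∃ C, 0 ≤ C ∧ ∀ᶠ n in atTop, BoundedBelow (Tn n).adjoint ((starRingEnd ℂ) z) C :=
  exists_eventually_boundedBelow (fun n => LinearPMap.adjoint_isFormalAdjoint (hTnd n)) hT hz
    fun h => hzS (mem_conjSet_of_conj_mem h)

theorem ConvergesGSR.mem_regionOfBoundedness (hTd : Dense (T.domain : Set H))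
    (hTnd : ∀ n, Dense ((Tn n).domain : Set (Hn n))) (hTnc : ∀ n, (Tn n).IsClosed)
    (hT : ConvergesGSR Tn T) (hT' : ConvergesGSR (fun n => (Tn n).adjoint) T.adjoint) {z : ℂ}
    (hz : z ∈ resolventSet T)
    (hzS : z ∉ limitingEssSpectrum Tn ∪
      conjSet (limitingEssSpectrum fun n => (Tn n).adjoint)) :
    z ∈ regionOfBoundedness Tn := by
  rw [Set.mem_union, not_or] at hzS
  obtain ⟨D, -, hD⟩ := hT.exists_boundedBelow_adjoint hTnd hz hzS.2
  -- Here the adjoints play the converging operators and `Tn n` their formal adjoints, at the point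
  -- `conj z`.
  obtain ⟨C, hC, h⟩ := exists_eventually_boundedBelow
    (fun n => (LinearPMap.adjoint_isFormalAdjoint (hTnd n)).symm) hT'
    (conj_mem_resolventSet_adjoint hTd hz) (by rw [Complex.conj_conj]; exact hzS.1)
  rw [Complex.conj_conj] at h
  refine ⟨C, hC, ?_⟩
  filter_upwards [h, hD] with n h1 h2
  exact ⟨mem_resolventSet_of_boundedBelow_adjoint (hTnc n) (hTnd n) hC h1 h2, h1⟩

theorem ConvergesGSR.mem_regionOfBoundedness_of_hasCompactResolvent
    (hTnd : ∀ n, Dense ((Tn n).domain : Set (Hn n))) (hT : ConvergesGSR Tn T)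
    (hc : ∀ n, HasCompactResolvent (Tn n)) {z : ℂ} (hz : z ∈ resolventSet T)
    (hzS : z ∉ conjSet (limitingEssSpectrum fun n => (Tn n).adjoint)) :
    z ∈ regionOfBoundedness Tn := by
  obtain ⟨C, hC, h⟩ := hT.exists_boundedBelow_adjoint hTnd hz hzS
  refine ⟨C, hC, h.mono fun n hn => ?_⟩
  exact mem_resolventBound_of_adjoint (hTnd n) hC
    (mem_resolventSet_of_isCompactOperator (hTnd n) (hc n) hn) hn

end Stability

end UnboundedOp

theorem mainTheorem1 {H₀ : Type*} [NormedAddCommGroup H₀] [InnerProductSpace ℂ H₀]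
    [CompleteSpace H₀] [TopologicalSpace.SeparableSpace H₀] (_hdim : ¬ FiniteDimensional ℂ H₀)
    (H : Submodule ℂ H₀) [CompleteSpace H]
    (Hn : ℕ → Submodule ℂ H₀) [∀ n, CompleteSpace (Hn n)]
    (_hP : ∀ x : H₀, Tendsto (fun n => ((Hn n).orthogonalProjectionOnto x : H₀)) atTop
      (𝓝 (H.orthogonalProjectionOnto x : H₀)))
    (T : H →ₗ.[ℂ] H) (_hTd : Dense (T.domain : Set H)) (_hTc : T.IsClosed)
    (Tn : ∀ n, Hn n →ₗ.[ℂ] Hn n) (_hTnd : ∀ n, Dense ((Tn n).domain : Set (Hn n)))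
    (_hTnc : ∀ n, (Tn n).IsClosed) :
    -- (i)
    ((UnboundedOp.ConvergesGSR Tn T ∧
        UnboundedOp.ConvergesGSR (fun n => (Tn n).adjoint) T.adjoint) →
      UnboundedOp.SpectrallyExactOutside Tn T
        (UnboundedOp.limitingEssSpectrum Tn ∪
          UnboundedOp.conjSet (UnboundedOp.limitingEssSpectrum fun n => (Tn n).adjoint))) ∧
    -- (ii)
    ((UnboundedOp.ConvergesGSR Tn T ∧ ∀ n, UnboundedOp.HasCompactResolvent (Tn n)) →
      UnboundedOp.SpectrallyExactOutside Tn T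
        (UnboundedOp.conjSet (UnboundedOp.limitingEssSpectrum fun n => (Tn n).adjoint))) ∧
    -- (iii)
    (∀ K : Set ℂ, IsCompact K → IsDiscrete (K ∩ UnboundedOp.spectrum T) →
      K ∩ UnboundedOp.spectrum T ⊆ interior K →
      ((UnboundedOp.ConvergesGSR Tn T ∧
          UnboundedOp.ConvergesGSR (fun n => (Tn n).adjoint) T.adjoint ∧
          K ∩ (UnboundedOp.limitingEssSpectrum Tn ∪
            UnboundedOp.conjSet (UnboundedOp.limitingEssSpectrum fun n => (Tn n).adjoint)) ⊆
              UnboundedOp.spectrum T) ∨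
        (UnboundedOp.ConvergesGSR Tn T ∧ (∀ n, UnboundedOp.HasCompactResolvent (Tn n)) ∧
          K ∩ UnboundedOp.conjSet (UnboundedOp.limitingEssSpectrum fun n => (Tn n).adjoint) ⊆
            UnboundedOp.spectrum T)) →
      Tendsto (fun n => Metric.hausdorffEDist (UnboundedOp.spectrum (Tn n) ∩ K)
        (UnboundedOp.spectrum T ∩ K)) atTop (𝓝 0)) := by
  refine ⟨fun ⟨h, h'⟩ => ?_, fun ⟨h, hc⟩ => ?_, fun K hK hd hint hcase => ?_⟩
  · exact h.spectrallyExactOutside _hP ((UnboundedOp.isClosed_limitingEssSpectrum _).union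
      (UnboundedOp.isClosed_conjSet (UnboundedOp.isClosed_limitingEssSpectrum _)))
      fun z hz hzS => h.mem_regionOfBoundedness _hTd _hTnd _hTnc h' hz hzS
  · exact h.spectrallyExactOutside _hP
      (UnboundedOp.isClosed_conjSet (UnboundedOp.isClosed_limitingEssSpectrum _))
      fun z hz hzS => h.mem_regionOfBoundedness_of_hasCompactResolvent _hTnd hc hz hzS
  · rcases hcase with ⟨h, h', hS⟩ | ⟨h, hc, hS⟩
    · exact h.tendsto_hausdorffEDist _hP hK hd hint fun z hzK hz =>
        h.mem_regionOfBoundedness _hTd _hTnd _hTnc h' hz fun hzS => hS ⟨hzK, hzS⟩ hz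
    · exact h.tendsto_hausdorffEDist _hP hK hd hint fun z hzK hz =>
        h.mem_regionOfBoundedness_of_hasCompactResolvent _hTnd hc hz fun hzS => hS ⟨hzK, hzS⟩ hz
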